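/- All graphs are finite and simple. For a graph $G$ with $n$ vertices and adjacency eigenvalues $\lambda_1,\dots,\lambda_n$, let $S_k(G)=\sum_{i=1}^n\lambda_i^k$. For graphs $G,H$ with $n$ vertices write $G\prec_s H$ if for some $k\in\{1,\dots,n-1\}$ one has $S_i(G)=S_i(H)$ for $0\le i\le k-1$ and $S_k(G)<S_k(H)$. Let $\mathscr T_n^{p,q}$ be the set of all $n$-vertex trees whose vertex set has a bipartition into independent sets of sizes $p$ and $q$. We say that $T_1,\dots,T_m$ are the last $m$ trees, in the $S$-order, among $\mathscr T_n^{p,q}$ if they belong to $\mathscr T_n^{p,q}$, $T_1\prec_s T_2\prec_s\cdots\prec_s T_m$, and every $T\in\mathscr T_n^{p,q}$ that is isomorphic to none of $T_1,\dots,T_m$ satisfies $T\prec_s T_j$ for all $j$. Let $B_{p,q}^{k,l}$ (with $k+l+1\le p$, $l+2\le q$) be the tree with $p$ white and $q$ black vertices, edges joining vertices of different colours only, in which a white vertex $u$ is adjacent to all $q$ black vertices, and the other $p-1$ white vertices are leaves: $k$ of them are attached to one black vertex $x$, $l$ of them are attached one each to $l$ further black vertices, and the remaining $p-1-k-l$ are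 attached to one further black vertex $v$. Let $D_{p,q}^{k,l}$ be the tree with $p$ white and $q$ black vertices defined in the same way with the two colours (and $p$, $q$) exchanged, that is, $D_{p,q}^{k,l}\cong B_{q,p}^{k,l}$. **Theorem.** Let $p,q,n$ be positive integers with $4\le p<q$ and $p+q=n$. (i) If $p>\frac{q+4}{2}$, the last four trees, in the $S$-order, among $\mathscr T_n^{p,q}$ are $B_{p,q}^{2,0},\,D_{p,q}^{0,1},\,B_{p,q}^{0,1},\,B_{p,q}^{0,0}$. (ii) If $p=\frac{q+4}{2}$, the last four trees, in the $S$-order, among $\mathscr T_n^{p,q}$ are $D_{p,q}^{0,1},\,B_{p,q}^{2,0},\,B_{p,q}^{0,1},\,B_{p,q}^{0,0}$. (iii) If $p<\frac{q+4}{2}$ and $p\ge 5$, the last four trees, in the $S$-order, among $\mathscr T_n^{p,q}$ are $B_{p,q}^{0,2},\,B_{p,q}^{2,0},\,B_{p,q}^{0,1},\,B_{p,q}^{0,0}$. If $p=4$ (in which case $p<\frac{q+4}{2}$ always holds), then $B_{p,q}^{2,0}\cong B_{p,q}^{0,1}$, and the last three trees, in the $S$-order, among $\mathscr T_n^{p,q}$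 are $B_{p,q}^{0,2},\,B_{p,q}^{0,1},\,B_{p,q}^{0,0}$. -/

import Mathlib

universe u v

open Classical in
/-- The `k`-th spectral moment of a finite graph: the sum of the `k`-th powers of the eigenvalues
(with multiplicity) of its real adjacency matrix. -/
noncomputable def spectralMoment {V : Type u} [Fintype V] (G : SimpleGraph V) (k : ℕ) : ℝ :=
  ∑ i, (G.isHermitian_adjMatrix ℝ).eigenvalues i ^ k

/-- `G` comes strictly before `H` in the `S`-order: for some `1 ≤ k ≤ n - 1`, where `n` is the
number of vertices, the moments of index `0, …, k - 1` agree and the `k`-th moment of `G` is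
smaller. (Agreement of the moments of index `0` says that `G` and `H` have equally many
vertices.) -/
def SBefore {V : Type u} {W : Type v} [Fintype V] [Fintype W]
    (G : SimpleGraph V) (H : SimpleGraph W) : Prop :=
  ∃ k : ℕ, 1 ≤ k ∧ k < Fintype.card V ∧
    (∀ i < k, spectralMoment G i = spectralMoment H i) ∧ spectralMoment G k < spectralMoment H k

/-- `G` is an `n`-vertex tree with a `(p, q)`-bipartition. -/
structure IsBipartitionedTree {V : Type u} [Fintype V] (n p q : ℕ) (G : SimpleGraph V) : Prop where
  isTree : G.IsTree
  card_eq : Fintype.card V = n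
  exists_parts : ∃ s t : Finset V, G.IsBipartiteWith s t ∧ (s : Set V) ∪ t = Set.univ ∧
    s.card = p ∧ t.card = q

/-- The trees in the list `L`, read from left to right, are the last `L.length` trees in the
`S`-order among all `n`-vertex trees with a `(p, q)`-bipartition, up to isomorphism: they are such
trees, each comes strictly before the later ones, and every such tree which is isomorphic to
none of them comes strictly before each of them. -/
structure AreLastTrees {W : Type v} [Fintype W] (n p q : ℕ) (L : List (SimpleGraph W)) : Prop where
  mem : ∀ G ∈ L, IsBipartitionedTree n p q G
  increasing : L.Pairwise fun G H => SBefore G H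
  last : ∀ (V : Type u) [Fintype V] (T : SimpleGraph V), IsBipartitionedTree n p q T →
    (∀ G ∈ L, IsEmpty (T ≃g G)) → ∀ G ∈ L, SBefore T G

/-- The bipartite graph on the disjoint union of `α` (white vertices) and `β` (black vertices)
in which a white vertex `i` and a black vertex `j` are adjacent iff `r i j`. -/
def bipartiteGraphOf {α : Type u} {β : Type v} (r : α → β → Prop) : SimpleGraph (α ⊕ β) where
  Adj a b :=
    match a, b with
    | Sum.inl i, Sum.inr j => r i j
    | Sum.inr j, Sum.inl i => r i j
    | _, _ => False
  symm := ⟨fun a b h => by cases a <;> cases b <;> exact h⟩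
  loopless := ⟨fun a h => by cases a <;> exact h⟩

/-- The index of the support vertex of the `i`-th leaf (`i = 1, 2, …`): the first `k` leaves hang
at vertex `1`, the next `l` leaves hang one each at the vertices `2, …, l + 1`, and all
remaining leaves hang at vertex `0`. -/
def supportIndex (k l i : ℕ) : ℕ :=
  if i ≤ k then 1 else if i ≤ k + l then i - k + 1 else 0

/-- The tree `B_{p,q}^{k,l}` (for `k + l + 1 ≤ p` and `l + 2 ≤ q`), with `p` white and `q` black
vertices. White vertex `0` is `u`, black vertex `0` is `v`. The vertex `u` is adjacent to all
black vertices. Of the `p - 1` other white vertices, which are leaves, `k` are attached to one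
and the same black vertex other than `v`, `l` are attached one each to `l` further black
vertices, and `p - 1 - k - l` are attached to `v`. -/
def treeB (p q k l : ℕ) : SimpleGraph (Fin p ⊕ Fin q) :=
  bipartiteGraphOf fun i j => i.val = 0 ∨ j.val = supportIndex k l i.val

/-- The tree `D_{p,q}^{k,l}` (for `k + l + 1 ≤ q` and `l + 2 ≤ p`): as `B`, with the colours
exchanged. The black vertex `0`, which is `v`, is adjacent to all `p` white vertices. Of the
`q - 1` other black vertices, which are leaves, `k` are attached to one and the same white vertex
other than `u` (the white vertex `0`), `l` are attached one each to `l` further white vertices,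
and `q - 1 - k - l` are attached to `u`. -/
def treeD (p q k l : ℕ) : SimpleGraph (Fin p ⊕ Fin q) :=
  bipartiteGraphOf fun i j => j.val = 0 ∨ i.val = supportIndex k l j.val

/-! All trees in question share $S_0$ and $S_2$, and their odd moments vanish, so the order is
decided by $S_4$ and, in case of a tie, by $S_6$.

Call a vertex adjacent to the whole other colour class a hub. A tree with a white hub is determined
by the numbers $f_j$ of leaves at the black vertices, which add up to $p-1$. The Gram matrix of its
biadjacency matrix is $J+\mathrm{diag}(f)$, so $S_4$ and $S_6$ amount to comparing $\sum f_j^2$ and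
then $\sum f_j^3$. The profiles $(p-1)$, $(p-2,1)$, $(p-3,2)$, $(p-3,1,1)$ give $B^{0,0}$,
$B^{0,1}$, $B^{2,0}$, $B^{0,2}$; any other has maximum at most $p-4$ and falls below $B^{0,2}$
(`momentLT_of_leafCount_le`).

With a black hub only, the counts add up to $q-1$ and are not concentrated at one vertex; all
profiles except $(q-2,1)$, which is $D^{0,1}$, fall below $B^{0,2}$. Without a hub, the degree
formula for $S_4$ (`spectralMoment_four`) again puts the tree below $B^{0,2}$. This is
`bipartitionedTree_cases`.

It remains to place $D^{0,1}$. With $N=p-4$ and $M=q-4$, half of $S_4(B^{2,0})-S_4(D^{0,1})$ is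
$2(M-2N)$, and for $B^{0,2}$ in place of $B^{2,0}$ it is $2(M-2N)-2$. So the threshold $p=(q+4)/2$
is $M=2N$; the ties at $M=2N$ and $M=2N+1$ are broken by $S_6$, with $D^{0,1}$ the smaller. -/

section Adjacency

variable {α : Type u} {β : Type v} (r : α → β → Prop)

@[simp] theorem bipartiteGraphOf_adj_inl_inr (i : α) (j : β) :
    (bipartiteGraphOf r).Adj (Sum.inl i) (Sum.inr j) ↔ r i j := Iff.rfl

@[simp] theorem bipartiteGraphOf_adj_inr_inl (i : α) (j : β) :
    (bipartiteGraphOf r).Adj (Sum.inr j) (Sum.inl i) ↔ r i j := Iff.rfl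

@[simp] theorem bipartiteGraphOf_adj_inl_inl (i i' : α) :
    ¬ (bipartiteGraphOf r).Adj (Sum.inl i) (Sum.inl i') := id

@[simp] theorem bipartiteGraphOf_adj_inr_inr (j j' : β) :
    ¬ (bipartiteGraphOf r).Adj (Sum.inr j) (Sum.inr j') := id

end Adjacency

/-! ### Spectral moments as traces of powers -/

theorem spectralMoment_eq_trace {V : Type*} [Fintype V] [DecidableEq V] (G : SimpleGraph V)
    [DecidableRel G.Adj] (k : ℕ) : spectralMoment G k = ((G.adjMatrix ℝ) ^ k).trace := by
  have h := (G.isHermitian_adjMatrix ℝ).spectral_theorem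
  have : spectralMoment G k = ∑ i, (G.isHermitian_adjMatrix ℝ).eigenvalues i ^ k := by
    unfold spectralMoment
    congr!
  rw [this]
  conv_rhs => rw [h, ← map_pow, Unitary.conjStarAlgAut_apply, Matrix.trace_mul_cycle,
    Unitary.coe_star_mul_self, one_mul, Matrix.diagonal_pow, Matrix.trace_diagonal]
  simp

theorem spectralMoment_congr {V W : Type*} [Fintype V] [Fintype W] {G : SimpleGraph V}
    {H : SimpleGraph W} (e : G ≃g H) (k : ℕ) : spectralMoment G k = spectralMoment H k := by
  classical
  rw [spectralMoment_eq_trace, spectralMoment_eq_trace]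
  have := e.reindex_adjMatrix ℝ
  rw [← this]
  change _ = ((Matrix.reindexAlgEquiv ℝ ℝ e.toEquiv (G.adjMatrix ℝ)) ^ k).trace
  rw [← map_pow]
  simp only [Matrix.trace, Matrix.diag, Matrix.coe_reindexAlgEquiv, Matrix.reindex_apply,
    Matrix.submatrix_apply]
  exact (e.toEquiv.symm.sum_comp fun i => ((G.adjMatrix ℝ) ^ k) i i).symm

/-! ### Moments of bipartite graphs through the biadjacency matrix -/

section Bipartite

variable {α β : Type*}

open Classical in
/-- The biadjacency matrix of a relation. -/
noncomputable def biadjMatrix (r : α → β → Prop) : Matrix α β ℝ :=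
  Matrix.of fun i j => if r i j then 1 else 0

theorem adjMatrix_bipartiteGraphOf (r : α → β → Prop) [DecidableRel (bipartiteGraphOf r).Adj] :
    (bipartiteGraphOf r).adjMatrix ℝ =
      Matrix.fromBlocks 0 (biadjMatrix r) (biadjMatrix r).transpose 0 := by
  ext (i | i) (j | j) <;> rw [SimpleGraph.adjMatrix_apply] <;>
    split_ifs with h <;> simp_all [biadjMatrix]

variable [Fintype α] [Fintype β]

theorem adjMatrix_sq_pow [DecidableEq α] [DecidableEq β] (r : α → β → Prop)
    [DecidableRel (bipartiteGraphOf r).Adj] (k : ℕ) :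
    ((bipartiteGraphOf r).adjMatrix ℝ) ^ (2 * k) =
      Matrix.fromBlocks ((biadjMatrix r * (biadjMatrix r).transpose) ^ k) 0 0
        (((biadjMatrix r).transpose * biadjMatrix r) ^ k) := by
  rw [adjMatrix_bipartiteGraphOf, pow_mul, pow_two, Matrix.fromBlocks_multiply]
  simp [Matrix.fromBlocks_diagonal_pow]

theorem trace_fromBlocks_eq (A : Matrix α α ℝ) (B : Matrix α β ℝ) (C : Matrix β α ℝ)
    (D : Matrix β β ℝ) : (Matrix.fromBlocks A B C D).trace = A.trace + D.trace := by
  simp [Matrix.trace]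

/-- Cyclicity of the trace applied to $(MN)^{k+1} = M(NM)^kN$. The exponent must be positive, since
the identity matrices on the two sides have different traces. -/
theorem trace_mul_pow_comm [DecidableEq α] [DecidableEq β] (M : Matrix α β ℝ) (N : Matrix β α ℝ)
    (k : ℕ) : ((M * N) ^ (k + 1)).trace = ((N * M) ^ (k + 1)).trace := by
  have h : ∀ k, (M * N) ^ k * M = M * (N * M) ^ k := by
    intro k
    induction k with
    | zero => simp
    | succ k ih => rw [pow_succ, Matrix.mul_assoc _ _ M, Matrix.mul_assoc M N M, ← Matrix.mul_assoc,
        ih, Matrix.mul_assoc, ← pow_succ]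
  rw [pow_succ, ← Matrix.mul_assoc, h, Matrix.mul_assoc, Matrix.trace_mul_comm, Matrix.mul_assoc,
    ← pow_succ]

theorem spectralMoment_even [DecidableEq β] (r : α → β → Prop) (k : ℕ) :
    spectralMoment (bipartiteGraphOf r) (2 * (k + 1)) =
      2 * (((biadjMatrix r).transpose * biadjMatrix r) ^ (k + 1)).trace := by
  classical
  rw [spectralMoment_eq_trace, adjMatrix_sq_pow, trace_fromBlocks_eq, trace_mul_pow_comm]
  ring

theorem spectralMoment_odd (r : α → β → Prop) (k : ℕ) :
    spectralMoment (bipartiteGraphOf r) (2 * k + 1) = 0 := by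
  classical
  rw [spectralMoment_eq_trace, pow_succ, adjMatrix_sq_pow, adjMatrix_bipartiteGraphOf,
    Matrix.fromBlocks_multiply, trace_fromBlocks_eq]
  simp

theorem spectralMoment_zero {V : Type*} [Fintype V] (G : SimpleGraph V) :
    spectralMoment G 0 = Fintype.card V := by
  simp [spectralMoment]

open Classical in
/-- The number of black neighbours of a white vertex. -/
noncomputable def rowCount (r : α → β → Prop) (i : α) : ℕ := (Finset.univ.filter fun j => r i j).card

theorem spectralMoment_two (r : α → β → Prop) :
    spectralMoment (bipartiteGraphOf r) 2 = 2 * ∑ i, (rowCount r i : ℝ) := by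
  classical
  have := spectralMoment_even r 0
  rw [zero_add, mul_one, pow_one, Matrix.trace_mul_comm] at this
  rw [this]
  congr 1
  refine Finset.sum_congr rfl fun i _ => ?_
  simp [Matrix.mul_apply, biadjMatrix, rowCount, ← ite_and]

theorem sum_rowCount_swap (r : α → β → Prop) :
    ∑ j, rowCount (fun j i => r i j) j = ∑ i, rowCount r i := by
  classical
  simp only [rowCount, Finset.card_filter]
  exact Finset.sum_comm

/-- For a bipartite graph without `4`-cycles, the fourth moment is determined by the degrees. -/
theorem spectralMoment_four (r : α → β → Prop)
    (h : ∀ i i' j j', i ≠ i' → r i j → r i j' → r i' j → r i' j' → j = j') :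
    spectralMoment (bipartiteGraphOf r) 4 = 2 * (∑ i, (rowCount r i : ℝ) ^ 2 +
      ∑ j, (rowCount (fun j i => r i j) j : ℝ) ^ 2 - ∑ i, (rowCount r i : ℝ)) := by
  classical
  have := spectralMoment_even r 1
  norm_num at this
  rw [this]
  congr 1
  rw [← one_add_one_eq_two, trace_mul_pow_comm, one_add_one_eq_two, pow_two]
  set C : Matrix α α ℝ := biadjMatrix r * (biadjMatrix r).transpose with hC
  have hCs : ∀ i i', C i' i = C i i' := by
    intro i i'
    simp only [hC, Matrix.mul_apply, Matrix.transpose_apply, mul_comm]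
  have hd : ∀ i, C i i = rowCount r i := by
    intro i; simp [hC, Matrix.mul_apply, biadjMatrix, rowCount, ← ite_and]
  -- Two distinct white vertices have at most one common neighbour, so off the diagonal $C$ is a 0/1
  -- matrix and squaring its entries changes nothing.
  have ho : ∀ i i', i ≠ i' → C i i' * C i i' = C i i' := by
    intro i i' hne
    have hc : C i i' = ((Finset.univ.filter fun j => r i j ∧ r i' j).card : ℝ) := by
      simp [hC, Matrix.mul_apply, biadjMatrix, ← ite_and, and_comm]
    have hle : (Finset.univ.filter fun j => r i j ∧ r i' j).card ≤ 1 := by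
      rw [Finset.card_le_one]
      intro a ha b hb
      simp only [Finset.mem_filter, Finset.mem_univ, true_and] at ha hb
      exact h i i' a b hne ha.1 hb.1 ha.2 hb.2
    rw [hc]
    interval_cases (Finset.univ.filter fun j => r i j ∧ r i' j).card <;> simp
  -- Both sides count pairs of edges sharing their black end.
  have hsum : ∑ i, ∑ i', C i i' = ∑ j, (rowCount (fun j i => r i j) j : ℝ) ^ 2 := by
    have h1 : ∀ i i', C i i' = ∑ j, biadjMatrix r i j * biadjMatrix r i' j := fun i i' => by
      simp [hC, Matrix.mul_apply]
    simp only [h1]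
    rw [Finset.sum_congr rfl fun i _ => Finset.sum_comm, Finset.sum_comm]
    refine Finset.sum_congr rfl fun j _ => ?_
    rw [pow_two, ← Finset.sum_mul_sum]
    simp [biadjMatrix, rowCount]
  have hrow : ∀ i, ∑ i', C i i' * C i' i =
      ∑ i', C i i' + ((rowCount r i : ℝ) ^ 2 - rowCount r i) := by
    intro i
    rw [← Finset.add_sum_erase _ _ (Finset.mem_univ i),
      ← Finset.add_sum_erase (a := i) _ (fun i' => C i i') (Finset.mem_univ i)]
    have : ∑ x ∈ Finset.univ.erase i, C i x * C x i = ∑ x ∈ Finset.univ.erase i, C i x :=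
      Finset.sum_congr rfl fun x hx => by
        rw [hCs i x, ho i x (Finset.ne_of_mem_erase hx).symm]
    rw [this, hd]
    ring
  simp only [Matrix.trace, Matrix.diag, Matrix.mul_apply, hrow]
  rw [Finset.sum_add_distrib, hsum, Finset.sum_sub_distrib]
  ring

end Bipartite

/-- The relation in which a white vertex sent to `none` is adjacent to all black vertices, and a
white vertex sent to `some j` is adjacent to `j` only. -/
def hubRel {α β : Type*} (g : α → Option β) (i : α) (j : β) : Prop := g i = none ∨ g i = some j

open Classical in
/-- The number of white leaves hanging at the black vertex `j`. -/
noncomputable def leafCount {α β : Type*} [Fintype α] (g : α → Option β) (j : β) : ℕ :=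
  (Finset.univ.filter fun i => g i = some j).card

/-- The function `f` takes the values `a`, `b`, `c` at three distinct points, and vanishes
elsewhere. -/
def HasProfile {β : Type*} (a b c : ℕ) (f : β → ℕ) : Prop :=
  ∃ x y z, x ≠ y ∧ x ≠ z ∧ y ≠ z ∧ f x = a ∧ f y = b ∧ f z = c ∧
    ∀ w, w ≠ x → w ≠ y → w ≠ z → f w = 0

/-! ### Leaf distributions, their isomorphism type and their power sums -/

section Profile

variable {β : Type*} {a b c : ℕ} {f f' : β → ℕ}

theorem HasProfile.swap (h : HasProfile a b c f) : HasProfile b a c f := by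
  obtain ⟨x, y, z, h1, h2, h3, h4, h5, h6, h7⟩ := h
  exact ⟨y, x, z, h1.symm, h3, h2, h5, h4, h6, fun w hy hx hz => h7 w hx hy hz⟩

/-- The symmetric group is 3-transitive, so the three marked points can be moved to the other three;
elsewhere both functions vanish. -/
theorem HasProfile.exists_perm (h : HasProfile a b c f) (h' : HasProfile a b c f') :
    ∃ σ : Equiv.Perm β, ∀ j, f' (σ j) = f j := by
  classical
  obtain ⟨x, y, z, hxy, hxz, hyz, h4, h5, h6, h7⟩ := h
  obtain ⟨x', y', z', hxy', hxz', hyz', h4', h5', h6', h7'⟩ := h'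
  have hi : Function.Injective ![x, y, z] := by
    intro i j; fin_cases i <;> fin_cases j <;> simp [hxy, hxz, hyz, hxy.symm, hxz.symm, hyz.symm]
  have hi' : Function.Injective ![x', y', z'] := by
    intro i j; fin_cases i <;> fin_cases j <;>
      simp [hxy', hxz', hyz', hxy'.symm, hxz'.symm, hyz'.symm]
  obtain ⟨σ, hσ⟩ := (Equiv.Perm.isMultiplyPretransitive β 3).exists_smul_eq ⟨_, hi⟩ ⟨_, hi'⟩
  have e0 := DFunLike.congr_fun hσ 0
  have e1 := DFunLike.congr_fun hσ 1
  have e2 := DFunLike.congr_fun hσ 2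
  simp only [Function.Embedding.smul_apply, Function.Embedding.coeFn_mk, Equiv.Perm.smul_def,
    Matrix.cons_val_zero, Matrix.cons_val_one, Matrix.cons_val] at e0 e1 e2
  refine ⟨σ, fun j => ?_⟩
  by_cases jx : j = x
  · rw [jx, e0, h4, h4']
  by_cases jy : j = y
  · rw [jy, e1, h5, h5']
  by_cases jz : j = z
  · rw [jz, e2, h6, h6']
  rw [h7 j jx jy jz, h7']
  · rw [← e0]; exact fun h => jx (σ.injective h)
  · rw [← e1]; exact fun h => jy (σ.injective h)
  · rw [← e2]; exact fun h => jz (σ.injective h)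

theorem HasProfile.sum_pow [Fintype β] (h : HasProfile a b c f) {k : ℕ} (hk : k ≠ 0) :
    ∑ j, f j ^ k = a ^ k + b ^ k + c ^ k := by
  classical
  obtain ⟨x, y, z, hxy, hxz, hyz, rfl, rfl, rfl, h7⟩ := h
  rw [← Finset.sum_subset (Finset.subset_univ {x, y, z})]
  · rw [Finset.sum_insert (by simp [hxy, hxz]), Finset.sum_insert (by simp [hyz]),
      Finset.sum_singleton, add_assoc]
  · intro w _ hw
    simp only [Finset.mem_insert, Finset.mem_singleton, not_or] at hw
    rw [h7 w hw.1 hw.2.1 hw.2.2, zero_pow hk]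

/-- A function with sum `N` is concentrated at one point up to a total of at most `2`, or all of
its values are at most `N - 3`. -/
theorem profile_cases [Fintype β] (hβ : 3 ≤ Fintype.card β) {N : ℕ} (hN : ∑ j, f j = N) :
    HasProfile N 0 0 f ∨ HasProfile (N - 1) 1 0 f ∨ HasProfile (N - 2) 2 0 f ∨
      HasProfile (N - 2) 1 1 f ∨ ∀ j, f j + 3 ≤ N := by
  classical
  by_cases hall : ∀ j, f j + 3 ≤ N
  · tauto
  push Not at hall
  obtain ⟨x, hx⟩ := hall
  -- The chosen point carries a nonzero value whenever some point of `s` does.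
  have pick : ∀ s : Finset β, s.Nonempty → ∃ y ∈ s, ∑ j ∈ s, f j ≠ 0 → f y ≠ 0 := by
    intro s ⟨y, hy⟩
    by_cases h : ∑ j ∈ s, f j = 0
    · exact ⟨y, hy, fun h' => absurd h h'⟩
    · obtain ⟨w, hw, hw'⟩ := Finset.exists_ne_zero_of_sum_ne_zero h
      exact ⟨w, hw, fun _ => hw'⟩
  have c1 : (Finset.univ.erase x).card = Fintype.card β - 1 := by simp
  obtain ⟨y, hy, hy'⟩ := pick (Finset.univ.erase x) (Finset.card_pos.1 (by omega))
  have c2 : ((Finset.univ.erase x).erase y).card = Fintype.card β - 1 - 1 := by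
    rw [Finset.card_erase_of_mem hy, c1]
  obtain ⟨z, hz, hz'⟩ := pick ((Finset.univ.erase x).erase y) (Finset.card_pos.1 (by omega))
  have s1 := Finset.add_sum_erase _ f (Finset.mem_univ x)
  have s2 := Finset.add_sum_erase _ f hy
  have s3 := Finset.add_sum_erase _ f hz
  set D := ∑ j ∈ ((Finset.univ.erase x).erase y).erase z, f j with hD
  -- At most 2 is left outside `x`, and `y`, `z` each absorb at least 1 as long as anything is left.
  have hD0 : D = 0 := by omega
  have hrest : ∀ w, w ≠ x → w ≠ y → w ≠ z → f w = 0 := fun w h1 h2 h3 =>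
    Finset.sum_eq_zero_iff.1 hD0 w (by simp [h1, h2, h3])
  simp only [Finset.mem_erase, ne_eq, Finset.mem_univ, and_true] at hy hz
  have key : ∀ a b c, f x = a → f y = b → f z = c → HasProfile a b c f := fun a b c h1 h2 h3 =>
    ⟨x, y, z, fun h => hy h.symm, fun h => hz.2 h.symm, fun h => hz.1 h.symm, h1, h2, h3, hrest⟩
  have hc : (f x = N ∧ f y = 0 ∧ f z = 0) ∨ (f x = N - 1 ∧ f y = 1 ∧ f z = 0) ∨
      (f x = N - 2 ∧ f y = 2 ∧ f z = 0) ∨ (f x = N - 2 ∧ f y = 1 ∧ f z = 1) := by omega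
  rcases hc with ⟨h1, h2, h3⟩ | ⟨h1, h2, h3⟩ | ⟨h1, h2, h3⟩ | ⟨h1, h2, h3⟩
  · exact .inl (key _ _ _ h1 h2 h3)
  · exact .inr (.inl (key _ _ _ h1 h2 h3))
  · exact .inr (.inr (.inl (key _ _ _ h1 h2 h3)))
  · exact .inr (.inr (.inr (.inl (key _ _ _ h1 h2 h3))))

theorem sum_sq_le_of_forall_add_three_le [Fintype β] {N : ℕ} (hN : ∑ j, f j = N) (hN3 : 3 ≤ N)
    (h : ∀ j, f j + 3 ≤ N) : ∑ j, f j ^ 2 ≤ (N - 2) ^ 2 + 2 := by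
  classical
  have hne : (Finset.univ : Finset β).Nonempty := by
    by_contra hemp
    rw [Finset.not_nonempty_iff_eq_empty] at hemp
    rw [hemp, Finset.sum_empty] at hN
    omega
  obtain ⟨x, -, hx⟩ := Finset.exists_max_image Finset.univ f hne
  have hmul : ∀ (s : Finset β) (m : ℕ), (∀ j ∈ s, f j ≤ m) → ∑ j ∈ s, f j ^ 2 ≤ m * ∑ j ∈ s, f j := by
    intro s m hm
    rw [Finset.mul_sum]
    refine Finset.sum_le_sum fun j hj => ?_
    rw [pow_two]
    exact Nat.mul_le_mul_right _ (hm j hj)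
  have hx3 := h x
  obtain ⟨M, rfl⟩ : ∃ M, N = M + 2 := ⟨N - 2, by omega⟩
  rw [Nat.add_sub_cancel]
  -- If the maximum $m$ is at least half of the total, the rest $R\ge 3$ contributes at most $R^2$,
  -- and $m^2+R^2$ is small enough by convexity. Otherwise $\sum f^2\le m\sum f$ suffices.
  by_cases hc : M + 2 ≤ 2 * f x
  · have s1 := Finset.add_sum_erase _ f (Finset.mem_univ x)
    have s2 := Finset.add_sum_erase _ (fun j => f j ^ 2) (Finset.mem_univ x)
    have s3 := hmul (Finset.univ.erase x) (∑ j ∈ Finset.univ.erase x, f j)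
      fun j hj => Finset.single_le_sum (f := f) (fun _ _ => Nat.zero_le _) hj
    generalize ∑ j ∈ Finset.univ.erase x, f j = R at *
    rw [← s2]
    obtain ⟨R', rfl⟩ : ∃ R', R = R' + 3 := ⟨R - 3, by omega⟩
    obtain ⟨m', hm'⟩ : ∃ m', f x = R' + 3 + m' := ⟨f x - (R' + 3), by omega⟩
    simp only [hm'] at *
    have : M = 2 * R' + m' + 4 := by omega
    subst this
    nlinarith
  · have h1 := hmul Finset.univ (f x) fun j hj => hx j hj
    rw [hN] at h1
    refine h1.trans ?_
    -- Here $(N-4)N=(N-2)^2-4$ for the original total $N = M+2$. The only other possibility is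
    -- $m=N-3<N/2$, which leaves finitely many totals.
    by_cases h4 : f x + 4 ≤ M + 2
    · nlinarith [Nat.mul_le_mul_right (M + 2) h4]
    · have : f x = M - 1 ∧ M ≤ 3 := by omega
      rw [this.1]
      have := this.2
      interval_cases M <;> norm_num

theorem sum_cube_le_of_forall_add_three_le [Fintype β] {N : ℕ} (h : ∀ j, f j + 3 ≤ N) :
    ∑ j, f j ^ 3 ≤ (N - 3) * ∑ j, f j ^ 2 := by
  rw [Finset.mul_sum]
  refine Finset.sum_le_sum fun j _ => ?_
  rw [pow_succ' (f j) 2]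
  exact Nat.mul_le_mul_right _ (by have := h j; omega)

end Profile

/-! ### Graphs with a hub: isomorphism and moments -/

section Hub

variable {α β : Type*} [Fintype α] {g g' : α → Option β}

theorem sum_leafCount [Fintype β] (hg : ∃! i, g i = none) : ∑ j, leafCount g j = Fintype.card α - 1 := by
  classical
  obtain ⟨u, hu, hu'⟩ := hg
  have h1 : ∀ j, leafCount g j = (Finset.univ.filter fun i => g i = some j).card := fun j => by
    unfold leafCount; congr!
  have h2 : Fintype.card α = ∑ o : Option β, (Finset.univ.filter fun i => g i = o).card :=
    Finset.card_eq_sum_card_fiberwise fun _ _ => Finset.mem_coe.2 (Finset.mem_univ _)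
  have h3 : (Finset.univ.filter fun i => g i = none) = {u} := by
    ext i; simp only [Finset.mem_filter, Finset.mem_univ, true_and, Finset.mem_singleton]
    exact ⟨hu' i, fun h => h ▸ hu⟩
  rw [Fintype.sum_option, h3, Finset.card_singleton] at h2
  simp only [h1]
  omega

/-- A permutation of the black vertices matching the leaf counts makes the fibres of `g` and `g'`
equinumerous, so the white vertices can be matched fibre by fibre. -/
theorem nonempty_iso_hub {a b c : ℕ} (hg : ∃! i, g i = none) (hg' : ∃! i, g' i = none)
    (h : HasProfile a b c (leafCount g)) (h' : HasProfile a b c (leafCount g')) :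
    Nonempty (bipartiteGraphOf (hubRel g) ≃g bipartiteGraphOf (hubRel g')) := by
  classical
  obtain ⟨σ, hσ⟩ := h.exists_perm h'
  have hfib : ∀ o, Nonempty ({i // (g i).map σ = o} ≃ {i // g' i = o}) := by
    intro o
    rw [← Fintype.card_eq, Fintype.card_subtype, Fintype.card_subtype]
    cases o with
    | none =>
      obtain ⟨u, hu, hu'⟩ := hg
      obtain ⟨v, hv, hv'⟩ := hg'
      have h1 : (Finset.univ.filter fun i => (g i).map σ = none) = {u} := by
        ext i
        simp only [Option.map_eq_none_iff, Finset.mem_filter, Finset.mem_univ, true_and,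
          Finset.mem_singleton]
        exact ⟨hu' i, fun h => h ▸ hu⟩
      have h2 : (Finset.univ.filter fun i => g' i = none) = {v} := by
        ext i; simp only [Finset.mem_filter, Finset.mem_univ, true_and, Finset.mem_singleton]
        exact ⟨hv' i, fun h => h ▸ hv⟩
      rw [h1, h2, Finset.card_singleton, Finset.card_singleton]
    | some j =>
      have := hσ (σ.symm j)
      rw [Equiv.apply_symm_apply] at this
      unfold leafCount at this
      convert this.symm using 3 with i
      · rw [Option.map_eq_some_iff]
        constructor
        · rintro ⟨k, hk, rfl⟩; simpa using hk
        · intro hk; exact ⟨_, hk, by simp⟩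
  let e := fun o => (hfib o).some
  refine ⟨⟨(Equiv.ofFiberEquiv e).sumCongr σ, ?_⟩⟩
  have hτ : ∀ i, g' (Equiv.ofFiberEquiv e i) = (g i).map σ := fun i => Equiv.ofFiberEquiv_map e i
  have hr : ∀ i j, hubRel g' (Equiv.ofFiberEquiv e i) (σ j) ↔ hubRel g i j := by
    intro i j
    unfold hubRel
    rw [hτ]
    cases g i <;> simp
  rintro (i | i) (j | j) <;> simp [hr, -Equiv.ofFiberEquiv_apply]

section Moments

/-- Distinct black vertices have the hub as their only common neighbour, so the Gram matrix is
$J+\mathrm{diag}(f)$. -/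
theorem biadjMatrix_hub [DecidableEq β] (hg : ∃! i, g i = none) (j j' : β) :
    ((biadjMatrix (hubRel g)).transpose * biadjMatrix (hubRel g)) j j' =
      1 + if j = j' then (leafCount g j : ℝ) else 0 := by
  classical
  obtain ⟨u, hu, hu'⟩ := hg
  have hterm : ∀ i, biadjMatrix (hubRel g) i j * biadjMatrix (hubRel g) i j' =
      (if i = u then 1 else 0) + if j = j' then (if g i = some j then 1 else 0) else 0 := by
    intro i
    by_cases hi : i = u
    · subst hi; simp [biadjMatrix, hubRel, hu]
    · have : g i ≠ none := fun h => hi (hu' i h)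
      by_cases hj : j = j'
      · subst hj; simp [biadjMatrix, hubRel, this, hi]
      · have h2 : ¬ (g i = some j ∧ g i = some j') := fun ⟨h1, h2⟩ =>
          hj (Option.some.inj (h1.symm.trans h2))
        by_cases h3 : g i = some j
        · have h4 : g i ≠ some j' := fun h4 => h2 ⟨h3, h4⟩
          simp [biadjMatrix, hubRel, this, hi, hj, h4]
        · simp [biadjMatrix, hubRel, this, hi, hj, h3]
  simp only [Matrix.mul_apply, Matrix.transpose_apply, hterm, Finset.sum_add_distrib]
  split_ifs with hj
  · simp only [Finset.sum_ite_eq', Finset.mem_univ, if_true, Finset.sum_boole]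
    unfold leafCount
    congr!
  · simp

variable [Fintype β]

theorem hub_sq_apply [DecidableEq β] (hg : ∃! i, g i = none) (j j' : β) :
    ((((biadjMatrix (hubRel g)).transpose * biadjMatrix (hubRel g)) ^ 2 : Matrix β β ℝ)) j j' =
      Fintype.card β + leafCount g j + leafCount g j' +
        if j = j' then (leafCount g j : ℝ) ^ 2 else 0 := by
  rw [pow_two, Matrix.mul_apply]
  simp only [biadjMatrix_hub hg, mul_add, add_mul, Finset.sum_add_distrib]
  split_ifs with h
  · subst h
    simp [pow_two]
    ring
  · simp [h]

theorem spectralMoment_four_hub (hg : ∃! i, g i = none) :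
    spectralMoment (bipartiteGraphOf (hubRel g)) 4 =
      2 * ((Fintype.card β : ℝ) ^ 2 + 2 * ((∑ j, leafCount g j : ℕ) : ℝ) +
        ((∑ j, leafCount g j ^ 2 : ℕ) : ℝ)) := by
  classical
  have := spectralMoment_even (hubRel g) 1
  norm_num at this
  rw [this]
  simp only [Matrix.trace, Matrix.diag, hub_sq_apply hg, if_true, Finset.sum_add_distrib]
  push_cast
  simp
  ring

/-- The expansion of $\mathrm{tr}\,(J+\mathrm{diag}(f))^3$, using $J^2=qJ$ with $q$ the number of
black vertices. -/
theorem spectralMoment_six_hub (hg : ∃! i, g i = none) :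
    spectralMoment (bipartiteGraphOf (hubRel g)) 6 =
      2 * ((Fintype.card β : ℝ) ^ 3 + 3 * Fintype.card β * ((∑ j, leafCount g j : ℕ) : ℝ) +
        3 * ((∑ j, leafCount g j ^ 2 : ℕ) : ℝ) + ((∑ j, leafCount g j ^ 3 : ℕ) : ℝ)) := by
  classical
  have := spectralMoment_even (hubRel g) 2
  norm_num at this
  rw [this]
  have hj : ∀ j, ((((biadjMatrix (hubRel g)).transpose * biadjMatrix (hubRel g)) ^ 3 : Matrix β β ℝ)) j j =
      (Fintype.card β : ℝ) ^ 2 + 2 * (Fintype.card β : ℝ) * leafCount g j +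
        3 * (leafCount g j : ℝ) ^ 2 + (leafCount g j : ℝ) ^ 3 + ∑ k, (leafCount g k : ℝ) := by
    intro j
    rw [pow_succ, Matrix.mul_apply]
    simp only [biadjMatrix_hub hg, hub_sq_apply hg, mul_add, add_mul, Finset.sum_add_distrib]
    simp
    ring
  simp only [Matrix.trace, Matrix.diag, hj, Finset.sum_add_distrib, ← Finset.mul_sum]
  push_cast
  simp
  ring

end Moments

end Hub

/-- Exchanging the two colours. -/
def bipartiteSwapIso {α β : Type*} (r : α → β → Prop) :
    bipartiteGraphOf r ≃g bipartiteGraphOf (fun j i => r i j) where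
  toEquiv := Equiv.sumComm α β
  map_rel_iff' := by rintro (i | i) (j | j) <;> simp

/-! ### Degrees in bipartite trees -/

section Edges

variable {α β : Type*} [Fintype α] [Fintype β] {r : α → β → Prop}

theorem card_edgeSet_bipartiteGraphOf (r : α → β → Prop) :
    Nat.card (bipartiteGraphOf r).edgeSet = ∑ i, rowCount r i := by
  classical
  have h := (bipartiteGraphOf r).sum_degrees_eq_twice_card_edges
  have h1 : ∀ i, (bipartiteGraphOf r).degree (Sum.inl i) = rowCount r i := by
    intro i
    rw [← SimpleGraph.card_neighborFinset_eq_degree, SimpleGraph.neighborFinset_eq_filter,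
      Finset.card_filter, Fintype.sum_sum_type]
    simp [rowCount]
  have h2 : ∀ j, (bipartiteGraphOf r).degree (Sum.inr j) = rowCount (fun j i => r i j) j := by
    intro i
    rw [← SimpleGraph.card_neighborFinset_eq_degree, SimpleGraph.neighborFinset_eq_filter,
      Finset.card_filter, Fintype.sum_sum_type]
    simp [rowCount]
  rw [Fintype.sum_sum_type] at h
  simp only [h1, h2, sum_rowCount_swap] at h
  rw [Nat.card_eq_fintype_card, ← SimpleGraph.edgeFinset_card]
  omega

theorem sum_rowCount_of_isTree (h : (bipartiteGraphOf r).IsTree) :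
    ∑ i, rowCount r i + 1 = Fintype.card α + Fintype.card β := by
  rw [← card_edgeSet_bipartiteGraphOf,
    (SimpleGraph.isTree_iff_connected_and_card.1 h).2, Nat.card_eq_fintype_card,
    Fintype.card_sum]

-- Two different common neighbours would give two different paths between `i` and `i'`, that is, a
-- 4-cycle.
omit [Fintype α] [Fintype β] in
theorem eq_of_isTree (h : (bipartiteGraphOf r).IsTree) (i i' : α) (j j' : β) (hi : i ≠ i')
    (h1 : r i j) (h2 : r i j') (h3 : r i' j) (h4 : r i' j') : j = j' := by
  have e : ∀ j, r i j → r i' j → ∃ w : (bipartiteGraphOf r).Path (Sum.inl i) (Sum.inl i'),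
      w.1.support = [Sum.inl i, Sum.inr j, Sum.inl i'] := by
    intro j h1 h2
    have a1 : (bipartiteGraphOf r).Adj (Sum.inl i) (Sum.inr j) := h1
    have a2 : (bipartiteGraphOf r).Adj (Sum.inr j) (Sum.inl i') := h2
    exact ⟨⟨.cons a1 (.cons a2 .nil), by simp [hi]⟩, rfl⟩
  obtain ⟨w, hw⟩ := e j h1 h3
  obtain ⟨w', hw'⟩ := e j' h2 h4
  rw [(h.2.subsingleton_path _ _).elim w w', hw'] at hw
  simpa using hw.symm

omit [Fintype α] [Fintype β] in
theorem exists_of_isTree [Nontrivial α] (h : (bipartiteGraphOf r).IsTree) (i : α) : ∃ j, r i j := by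
  have : Nontrivial (α ⊕ β) := Sum.inl_injective.nontrivial
  obtain ⟨w, hw⟩ := h.1.preconnected.exists_adj_of_nontrivial (Sum.inl i)
  cases w with
  | inl i' => exact absurd hw (by simp)
  | inr j => exact ⟨j, hw⟩

omit [Fintype α] in
theorem rowCount_pos_of_isTree [Nontrivial α] (h : (bipartiteGraphOf r).IsTree) (i : α) :
    0 < rowCount r i := by
  classical
  obtain ⟨j, hj⟩ := exists_of_isTree h i
  exact Finset.card_pos.2 ⟨j, by simpa using hj⟩

omit [Fintype α] in
/-- A tree in which a white vertex is adjacent to all black vertices is a hub graph. -/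
theorem exists_hub_of_full_row [Nontrivial α] [Nontrivial β] (h : (bipartiteGraphOf r).IsTree)
    {u : α} (hu : Fintype.card β ≤ rowCount r u) :
    ∃ g : α → Option β, (∃! i, g i = none) ∧ r = hubRel g := by
  classical
  have hu' : ∀ j, r u j := by
    intro j
    have := Finset.eq_univ_of_card _ (le_antisymm (Finset.card_le_univ _) hu)
    simpa using (Finset.ext_iff.1 this j)
  choose f hf using exists_of_isTree h
  refine ⟨fun i => if i = u then none else some (f i), ⟨u, by simp, fun i hi => ?_⟩, ?_⟩
  · by_contra hne
    simp [hne] at hi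
  · funext i j
    refine propext ?_
    by_cases hi : i = u
    · subst hi; simp [hubRel, hu']
    · simp only [hubRel, hi, if_false, reduceCtorEq, false_or, Option.some.injEq]
      -- The hub sees every black vertex, so a second neighbour of `i` would be a second common
      -- neighbour with the hub.
      exact ⟨fun hj => eq_of_isTree h i u _ _ hi (hf i) hj (hu' _) (hu' _), fun hj => hj ▸ hf i⟩

omit [Fintype β] in
/-- The number of neighbours of a black vertex in a hub graph. -/
theorem rowCount_swap_hub {g : α → Option β} (hg : ∃! i, g i = none) (j : β) :
    rowCount (fun j i => hubRel g i j) j = leafCount g j + 1 := by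
  classical
  obtain ⟨u, hu, hu'⟩ := hg
  have : (Finset.univ.filter fun i => hubRel g i j) =
      insert u (Finset.univ.filter fun i => g i = some j) := by
    ext i
    have h1 : g i = none ↔ i = u := ⟨hu' i, fun h => h ▸ hu⟩
    rw [Finset.mem_filter, Finset.mem_insert, Finset.mem_filter]
    simp [hubRel, h1]
  have h2 : u ∉ Finset.univ.filter fun i => g i = some j := by simp [hu]
  have h3 := Finset.card_insert_of_notMem h2
  rw [← this] at h3
  unfold rowCount leafCount
  convert h3

theorem isTree_hub {g : α → Option β} (hg : ∃! i, g i = none) :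
    (bipartiteGraphOf (hubRel g)).IsTree := by
  classical
  rw [SimpleGraph.isTree_iff_connected_and_card]
  constructor
  · obtain ⟨u, hu, hu'⟩ := hg
    have hb : ∀ j : β, (bipartiteGraphOf (hubRel g)).Reachable (Sum.inr j) (Sum.inl u) :=
      fun j => SimpleGraph.Adj.reachable (by simp [hubRel, hu])
    refine SimpleGraph.connected_iff_exists_forall_reachable _ |>.2 ⟨Sum.inl u, ?_⟩
    rintro (i | j)
    · cases hi : g i with
      | none => rw [hu' i hi]
      | some j =>
        have : (bipartiteGraphOf (hubRel g)).Adj (Sum.inl i) (Sum.inr j) := by simp [hubRel, hi]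
        exact (this.reachable.trans (hb j)).symm
    · exact (hb j).symm
  · rw [card_edgeSet_bipartiteGraphOf, ← sum_rowCount_swap]
    simp only [rowCount_swap_hub hg, Finset.sum_add_distrib, sum_leafCount hg]
    have : 0 < Fintype.card α := Fintype.card_pos_iff.2 ⟨hg.choose⟩
    simp
    omega

end Edges

/-! ### Trees without a hub, and encoding by relations -/

section Trees

/-- Short of full concentration at one point, the best profile for squares is $(N+2,1,0)$. -/
theorem sum_sq_le_of_forall_lt {β : Type*} [Fintype β] (hβ : 3 ≤ Fintype.card β) {f : β → ℕ}
    {N : ℕ} (hN : ∑ j, f j = N + 3) (h : ∀ j, f j < N + 3) : ∑ j, f j ^ 2 ≤ (N + 2) ^ 2 + 1 := by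
  rcases profile_cases hβ hN with h1 | h1 | h1 | h1 | h1
  · obtain ⟨x, -, -, -, -, -, hx, -⟩ := h1
    exact absurd (h x) (by omega)
  · rw [h1.sum_pow two_ne_zero]
    simp
  · rw [h1.sum_pow two_ne_zero]
    change (N + 1) ^ 2 + _ + _ ≤ _
    nlinarith
  · rw [h1.sum_pow two_ne_zero]
    change (N + 1) ^ 2 + _ + _ ≤ _
    nlinarith
  · refine (sum_sq_le_of_forall_add_three_le hN (by omega) h1).trans ?_
    change (N + 1) ^ 2 + _ ≤ _
    nlinarith

theorem spectralMoment_four_le_of_rowCount_lt {N M : ℕ} {r : Fin (N + 4) → Fin (M + 4) → Prop}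
    (h : (bipartiteGraphOf r).IsTree) (hr : ∀ i, rowCount r i < M + 4)
    (hc : ∀ j, rowCount (fun j i => r i j) j < N + 4) :
    spectralMoment (bipartiteGraphOf r) 4 ≤
      2 * (((M : ℝ) + 2) ^ 2 + (N + 2) ^ 2 + 2 * N + 2 * M + 15) := by
  have h' := (bipartiteSwapIso r).isTree_iff.1 h
  -- The excess degrees $d-1$ on one side add up to one less than the size of the other side;
  -- without a hub they are not concentrated at one vertex. This is used for both colours.
  have key : ∀ {P Q : ℕ} (s : Fin (P + 4) → Fin (Q + 4) → Prop), (bipartiteGraphOf s).IsTree →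
      (∀ i, rowCount s i < Q + 4) →
      ∑ i, (rowCount s i : ℝ) ^ 2 ≤ ((Q : ℝ) + 2) ^ 2 + 1 + 2 * (Q + 3) + (P + 4) := by
    intro P Q s hs hlt
    have hpos := rowCount_pos_of_isTree hs
    have hsum := sum_rowCount_of_isTree hs
    simp only [Fintype.card_fin] at hsum
    choose f hf using fun i => Nat.exists_eq_succ_of_ne_zero (hpos i).ne'
    simp only [hf, Nat.succ_eq_add_one, Finset.sum_add_distrib] at hsum
    simp at hsum
    have h1 : ∑ i, f i = Q + 3 := by omega
    have h2 := sum_sq_le_of_forall_lt (by simp) h1 (fun i => by have := hlt i; rw [hf] at this; omega)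
    have h3 : ∑ i, rowCount s i ^ 2 = ∑ i, f i ^ 2 + 2 * ∑ i, f i + (P + 4) := by
      simp only [hf, Nat.succ_eq_add_one, add_sq, Finset.sum_add_distrib, Finset.mul_sum]
      simp
    have h4 : ∑ i, rowCount s i ^ 2 ≤ (Q + 2) ^ 2 + 1 + 2 * (Q + 3) + (P + 4) := by omega
    exact_mod_cast h4
  have h1 := key r h hr
  have h2 := key _ h' hc
  have h3 := sum_rowCount_of_isTree h
  rw [spectralMoment_four r (eq_of_isTree h)]
  have h4 : ∑ i, (rowCount r i : ℝ) = N + M + 7 := by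
    simp only [Fintype.card_fin] at h3
    have : ∑ i, rowCount r i = N + M + 7 := by omega
    exact_mod_cast this
  rw [h4]
  linarith

theorem IsBipartitionedTree.exists_rel {V : Type*} [Fintype V] {n p q : ℕ} {T : SimpleGraph V}
    (h : IsBipartitionedTree n p q T) :
    ∃ r : Fin p → Fin q → Prop, Nonempty (T ≃g bipartiteGraphOf r) := by
  classical
  obtain ⟨s, t, hst, hu, hs, ht⟩ := h.exists_parts
  have ht' : ∀ v, v ∈ t ↔ v ∉ s := by
    intro v
    constructor
    · intro hv hv'
      exact Set.disjoint_left.1 hst.disjoint (Finset.mem_coe.2 hv') (Finset.mem_coe.2 hv)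
    · intro hv
      have : v ∈ (s : Set V) ∪ t := hu ▸ Set.mem_univ v
      simpa [hv] using this
  let e1 : Fin p ≃ {v // v ∈ s} := (s.equivFinOfCardEq hs).symm
  let e2 : Fin q ≃ {v // v ∉ s} := (t.equivFinOfCardEq ht).symm.trans (Equiv.subtypeEquivRight ht')
  let e : Fin p ⊕ Fin q ≃ V := (e1.sumCongr e2).trans (Equiv.sumCompl fun v => v ∈ s)
  have he1 : ∀ i, e (Sum.inl i) ∈ s := fun i => (e1 i).2
  have he2 : ∀ j, e (Sum.inr j) ∉ s := fun j => (e2 j).2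
  refine ⟨fun i j => T.Adj (e (Sum.inl i)) (e (Sum.inr j)), ⟨RelIso.symm ⟨e, ?_⟩⟩⟩
  rintro (i | i) (j | j)
  · simp only [bipartiteGraphOf_adj_inl_inl, iff_false]
    intro hadj
    have := hst.mem_of_adj hadj
    simp [ht', he1] at this
  · rfl
  · exact T.adj_comm _ _
  · simp only [bipartiteGraphOf_adj_inr_inr, iff_false]
    intro hadj
    have := hst.mem_of_adj hadj
    simp [he2] at this

theorem isBipartitionedTree_of_isTree {p q : ℕ} {r : Fin p → Fin q → Prop}
    (h : (bipartiteGraphOf r).IsTree) : IsBipartitionedTree (p + q) p q (bipartiteGraphOf r) where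
  isTree := h
  card_eq := by simp
  exists_parts := by
    refine ⟨Finset.univ.map .inl, Finset.univ.map .inr, ⟨?_, ?_⟩, ?_, by simp, by simp⟩
    · rw [Set.disjoint_left]; rintro (i | i) <;> simp
    · rintro (i | i) (j | j) <;> simp
    · ext (i | i) <;> simp

end Trees

/-- `T` is a tree on `p` white and `q` black vertices in which one white vertex is adjacent to all
black vertices, and `a`, `b`, `c` of the other white vertices are leaves at three distinct
black vertices. -/
def IsHubTree {V : Type*} (p q a b c : ℕ) (T : SimpleGraph V) : Prop :=
  ∃ g : Fin p → Option (Fin q), (∃! i, g i = none) ∧ HasProfile a b c (leafCount g) ∧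
    Nonempty (T ≃g bipartiteGraphOf (hubRel g))

namespace IsHubTree

variable {V : Type u} {W : Type v} {p q a b c : ℕ} {T : SimpleGraph V} {T' : SimpleGraph W}

theorem nonempty_iso (h : IsHubTree p q a b c T) (h' : IsHubTree p q a b c T') :
    Nonempty (T ≃g T') := by
  obtain ⟨g, h1, h2, ⟨e⟩⟩ := h
  obtain ⟨g', h1', h2', ⟨e'⟩⟩ := h'
  obtain ⟨e''⟩ := nonempty_iso_hub h1 h1' h2 h2'
  exact ⟨e.trans (e''.trans e'.symm)⟩

theorem sum_leafCount_eq {g : Fin p → Option (Fin q)}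
    (h : HasProfile a b c (leafCount g)) : ∑ j, leafCount g j = a + b + c := by
  simpa using h.sum_pow one_ne_zero

theorem spectralMoment_four [Fintype V] (h : IsHubTree p q a b c T) :
    spectralMoment T 4 = 2 * ((q : ℝ) ^ 2 + 2 * (a + b + c) + (a ^ 2 + b ^ 2 + c ^ 2)) := by
  obtain ⟨g, h1, h2, ⟨e⟩⟩ := h
  rw [spectralMoment_congr e, spectralMoment_four_hub h1, h2.sum_pow two_ne_zero, sum_leafCount_eq h2]
  simp

theorem spectralMoment_six [Fintype V] (h : IsHubTree p q a b c T) :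
    spectralMoment T 6 = 2 * ((q : ℝ) ^ 3 + 3 * q * (a + b + c) + 3 * (a ^ 2 + b ^ 2 + c ^ 2) +
      (a ^ 3 + b ^ 3 + c ^ 3)) := by
  obtain ⟨g, h1, h2, ⟨e⟩⟩ := h
  rw [spectralMoment_congr e, spectralMoment_six_hub h1, h2.sum_pow two_ne_zero,
    h2.sum_pow three_ne_zero, sum_leafCount_eq h2]
  simp

end IsHubTree

/-! ### Reduction of the $S$-order to the fourth and sixth moments -/

section Moments

variable {V : Type u} {W : Type v} [Fintype V] [Fintype W] {n p q : ℕ} {T : SimpleGraph V}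
  {T' : SimpleGraph W}

theorem IsBipartitionedTree.spectralMoment_odd (h : IsBipartitionedTree n p q T) (k : ℕ) :
    spectralMoment T (2 * k + 1) = 0 := by
  obtain ⟨r, ⟨e⟩⟩ := h.exists_rel
  rw [spectralMoment_congr e, _root_.spectralMoment_odd]

theorem IsBipartitionedTree.spectralMoment_two (h : IsBipartitionedTree n p q T) :
    spectralMoment T 2 = 2 * ((p : ℝ) + q - 1) := by
  obtain ⟨r, ⟨e⟩⟩ := h.exists_rel
  have hr := sum_rowCount_of_isTree (e.isTree_iff.1 h.isTree)
  rw [spectralMoment_congr e, _root_.spectralMoment_two]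
  simp only [Fintype.card_fin] at hr
  have : ∑ i, (rowCount r i : ℝ) + 1 = p + q := by exact_mod_cast hr
  rw [← this, add_sub_cancel_right]

/-- Lexicographic comparison by the fourth and the sixth spectral moment. -/
def MomentLT (T : SimpleGraph V) (T' : SimpleGraph W) : Prop :=
  spectralMoment T 4 < spectralMoment T' 4 ∨
    (spectralMoment T 4 = spectralMoment T' 4 ∧ spectralMoment T 6 < spectralMoment T' 6)

/-- Moments 0 and 2 and the odd ones depend only on `p`, `q`; `6 < n` keeps index 6 within the range
admitted by the $S$-order. -/
theorem MomentLT.sBefore (hn : 6 < n) (h : IsBipartitionedTree n p q T)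
    (h' : IsBipartitionedTree n p q T') (hlt : MomentLT T T') : SBefore T T' := by
  have h0 : spectralMoment T 0 = spectralMoment T' 0 := by
    rw [spectralMoment_zero, spectralMoment_zero, h.card_eq, h'.card_eq]
  have h1 : ∀ k, spectralMoment T (2 * k + 1) = spectralMoment T' (2 * k + 1) := fun k => by
    rw [h.spectralMoment_odd, h'.spectralMoment_odd]
  have h2 : spectralMoment T 2 = spectralMoment T' 2 := by
    rw [h.spectralMoment_two, h'.spectralMoment_two]
  have hcard := h.card_eq
  rcases hlt with h4 | ⟨h4, h6⟩
  · refine ⟨4, by norm_num, by omega, fun i hi => ?_, h4⟩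
    interval_cases i
    exacts [h0, h1 0, h2, h1 1]
  · refine ⟨6, by norm_num, by omega, fun i hi => ?_, h6⟩
    interval_cases i
    exacts [h0, h1 0, h2, h1 1, h4, h1 2]

theorem MomentLT.trans {U : Type*} [Fintype U] {T'' : SimpleGraph U} (h : MomentLT T T')
    (h' : MomentLT T' T'') : MomentLT T T'' := by
  unfold MomentLT at *
  rcases h with h | ⟨h1, h2⟩ <;> rcases h' with h' | ⟨h1', h2'⟩
  · exact .inl (h.trans h')
  · exact .inl (h1' ▸ h)
  · exact .inl (h1 ▸ h')
  · exact .inr ⟨h1.trans h1', h2.trans h2'⟩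

/-- By transitivity, an unlisted tree need only be compared with the smallest listed one. -/
theorem areLastTrees_cons {G₀ : SimpleGraph W} {L : List (SimpleGraph W)} (hn : 6 < n)
    (hmem : ∀ G ∈ G₀ :: L, IsBipartitionedTree n p q G) (hinc : (G₀ :: L).Pairwise MomentLT)
    (hlast : ∀ (V : Type u) [Fintype V] (T : SimpleGraph V), IsBipartitionedTree n p q T →
      (∀ G ∈ G₀ :: L, IsEmpty (T ≃g G)) → MomentLT T G₀) :
    AreLastTrees.{u} n p q (G₀ :: L) where
  mem := hmem
  increasing := hinc.imp_of_mem fun ha hb h => h.sBefore hn (hmem _ ha) (hmem _ hb)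
  last V _ T hT hL G hG := by
    refine MomentLT.sBefore hn hT (hmem G hG) ?_
    have h0 := hlast V T hT hL
    rcases List.mem_cons.1 hG with rfl | hG'
    · exact h0
    · exact h0.trans (List.rel_of_pairwise_cons hinc hG')

end Moments

/-! ### Profiles of the extremal trees -/

section Special

-- As $k+l\le 2$, only leaves 1 and 2 can hang away from $v$; the other $P+1$ leaves hang at $v$.
open Classical in
theorem exists_treeB_eq_hub {P Q k l : ℕ} (hkl : k + l ≤ 2) :
    ∃ g : Fin (P + 4) → Option (Fin (Q + 4)), (∃! i, g i = none) ∧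
      treeB (P + 4) (Q + 4) k l = bipartiteGraphOf (hubRel g) ∧
      ∀ j, leafCount g j = (if j.val = supportIndex k l 1 then 1 else 0) +
        ((if j.val = supportIndex k l 2 then 1 else 0) + if j.val = 0 then P + 1 else 0) := by
  have hs : ∀ i, supportIndex k l i < Q + 4 := by
    intro i; unfold supportIndex; split_ifs <;> omega
  refine ⟨fun i => if i.val = 0 then none else some ⟨supportIndex k l i.val, hs _⟩,
    ⟨0, by simp, fun i hi => ?_⟩, ?_, fun j => ?_⟩
  · by_contra h
    have : i.val ≠ 0 := fun h' => h (Fin.ext h')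
    simp [this] at hi
  · unfold treeB
    congr 1
    funext i j
    refine propext ?_
    by_cases hi : i.val = 0
    · simp [hubRel, hi]
    · simp [hubRel, hi, Fin.ext_iff, eq_comm]
  · have h3 : ∀ i, supportIndex k l (i + 1 + 1 + 1) = 0 := by
      intro i; unfold supportIndex; rw [if_neg (by omega), if_neg (by omega)]
    unfold leafCount
    rw [Finset.card_filter]
    iterate 3 rw [Fin.sum_univ_succ]
    simp only [Fin.val_succ, h3]
    have hv : ∀ a h, (some (⟨a, h⟩ : Fin (Q + 4)) = some j) ↔ j.val = a := fun a h => by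
      rw [Option.some.injEq, Fin.ext_iff, eq_comm]
    simp [hv]

theorem isBipartitionedTree_treeB {P Q k l : ℕ} (hkl : k + l ≤ 2) :
    IsBipartitionedTree (P + 4 + (Q + 4)) (P + 4) (Q + 4) (treeB (P + 4) (Q + 4) k l) := by
  obtain ⟨g, hg, h, -⟩ := exists_treeB_eq_hub (P := P) (Q := Q) hkl
  rw [h]
  exact isBipartitionedTree_of_isTree (isTree_hub hg)

theorem isHubTree_treeB {P Q k l a b c : ℕ} (hkl : k + l ≤ 2)
    (h : ∀ f : Fin (Q + 4) → ℕ, (∀ j, f j = (if j.val = supportIndex k l 1 then 1 else 0) +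
        ((if j.val = supportIndex k l 2 then 1 else 0) + if j.val = 0 then P + 1 else 0)) →
      HasProfile a b c f) :
    IsHubTree (P + 4) (Q + 4) a b c (treeB (P + 4) (Q + 4) k l) := by
  obtain ⟨g, hg, hT, hl⟩ := exists_treeB_eq_hub (P := P) (Q := Q) hkl
  exact ⟨g, hg, h _ hl, ⟨hT ▸ RelIso.refl _⟩⟩

theorem hasProfile_of_val {m a b c x y z : ℕ} {f : Fin m → ℕ} {φ : ℕ → ℕ} (hx : x < m) (hy : y < m)
    (hz : z < m) (hxy : x ≠ y) (hxz : x ≠ z) (hyz : y ≠ z) (hf : ∀ j, f j = φ j.val)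
    (ha : φ x = a) (hb : φ y = b) (hc : φ z = c)
    (h0 : ∀ w, w ≠ x → w ≠ y → w ≠ z → φ w = 0) : HasProfile a b c f :=
  ⟨⟨x, hx⟩, ⟨y, hy⟩, ⟨z, hz⟩, fun h => hxy (Fin.ext_iff.1 h), fun h => hxz (Fin.ext_iff.1 h),
    fun h => hyz (Fin.ext_iff.1 h), (hf _).trans ha, (hf _).trans hb, (hf _).trans hc,
    fun w h1 h2 h3 => (hf w).trans (h0 _ (fun h => h1 (Fin.ext h)) (fun h => h2 (Fin.ext h))
      fun h => h3 (Fin.ext h))⟩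

theorem isHubTree_treeB_zero_zero (P Q : ℕ) :
    IsHubTree (P + 4) (Q + 4) (P + 3) 0 0 (treeB (P + 4) (Q + 4) 0 0) :=
  isHubTree_treeB (by norm_num) fun f hf => by
    simp only [show supportIndex 0 0 1 = 0 from rfl,
      show supportIndex 0 0 2 = 0 from rfl] at hf
    exact hasProfile_of_val (φ := fun w => (if w = 0 then 1 else 0) +
        ((if w = 0 then 1 else 0) + if w = 0 then P + 1 else 0)) (x := 0) (y := 1) (z := 2) (by omega) (by omega) (by omega)
      (by norm_num) (by norm_num) (by norm_num) hf (by simp; omega) rfl rfl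
      fun w hx _ _ => by simp [hx]

theorem isHubTree_treeB_zero_one (P Q : ℕ) :
    IsHubTree (P + 4) (Q + 4) (P + 2) 1 0 (treeB (P + 4) (Q + 4) 0 1) :=
  isHubTree_treeB (by norm_num) fun f hf => by
    simp only [show supportIndex 0 1 1 = 2 from rfl,
      show supportIndex 0 1 2 = 0 from rfl] at hf
    -- For $k=0$ black vertex 1 carries no leaf, since single leaves start at vertex 2; so 1 serves
    -- as the empty third point.
    exact hasProfile_of_val (φ := fun w => (if w = 2 then 1 else 0) +
        ((if w = 0 then 1 else 0) + if w = 0 then P + 1 else 0)) (x := 0) (y := 2) (z := 1) (by omega) (by omega) (by omega)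
      (by norm_num) (by norm_num) (by norm_num) hf (by simp; omega) rfl rfl
      fun w hx hy _ => by simp [hx, hy]

theorem isHubTree_treeB_two_zero (P Q : ℕ) :
    IsHubTree (P + 4) (Q + 4) (P + 1) 2 0 (treeB (P + 4) (Q + 4) 2 0) :=
  isHubTree_treeB (by norm_num) fun f hf => by
    simp only [show supportIndex 2 0 1 = 1 from rfl,
      show supportIndex 2 0 2 = 1 from rfl] at hf
    exact hasProfile_of_val (φ := fun w => (if w = 1 then 1 else 0) +
        ((if w = 1 then 1 else 0) + if w = 0 then P + 1 else 0)) (x := 0) (y := 1) (z := 2) (by omega) (by omega) (by omega)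
      (by norm_num) (by norm_num) (by norm_num) hf (by simp) rfl rfl
      fun w hx hy _ => by simp [hx, hy]

theorem isHubTree_treeB_zero_two (P Q : ℕ) :
    IsHubTree (P + 4) (Q + 4) (P + 1) 1 1 (treeB (P + 4) (Q + 4) 0 2) :=
  isHubTree_treeB (by norm_num) fun f hf => by
    simp only [show supportIndex 0 2 1 = 2 from rfl,
      show supportIndex 0 2 2 = 3 from rfl] at hf
    exact hasProfile_of_val (φ := fun w => (if w = 2 then 1 else 0) +
        ((if w = 3 then 1 else 0) + if w = 0 then P + 1 else 0)) (x := 0) (y := 2) (z := 3) (by omega) (by omega) (by omega)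
      (by norm_num) (by norm_num) (by norm_num) hf (by simp) rfl rfl
      fun w hx hy hz => by simp [hx, hy, hz]

/-- Exchanging the colours turns `D` into `B`. -/
def treeDIsoTreeB (p q k l : ℕ) : treeD p q k l ≃g treeB q p k l := bipartiteSwapIso _

theorem isBipartitionedTree_treeD {P Q k l : ℕ} (hkl : k + l ≤ 2) :
    IsBipartitionedTree (P + 4 + (Q + 4)) (P + 4) (Q + 4) (treeD (P + 4) (Q + 4) k l) :=
  isBipartitionedTree_of_isTree
    ((treeDIsoTreeB _ _ _ _).isTree_iff.2 (isBipartitionedTree_treeB hkl).isTree)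

theorem isHubTree_treeD_zero_one (P Q : ℕ) :
    IsHubTree (Q + 4) (P + 4) (Q + 2) 1 0 (treeD (P + 4) (Q + 4) 0 1) := by
  obtain ⟨g, h1, h2, ⟨e⟩⟩ := isHubTree_treeB_zero_one Q P
  exact ⟨g, h1, h2, ⟨(treeDIsoTreeB _ _ _ _).trans e⟩⟩

end Special

/-! ### Classification of trees not below $B^{0,2}$ -/

section Classification

variable {V : Type u} {W : Type v} [Fintype V] [Fintype W] {n N M : ℕ} {T : SimpleGraph V}
  {T' : SimpleGraph W}

/-- A hub graph whose hub has `N + 3` descendants, of which at most `N` at each black vertex, has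
smaller moments than the one with profile `(N + 1, 1, 1)`. -/
theorem momentLT_of_leafCount_le {g : Fin (N + 4) → Option (Fin (M + 4))} (hg : ∃! i, g i = none)
    (h : ∀ j, leafCount g j + 3 ≤ N + 3) (hT' : IsHubTree (N + 4) (M + 4) (N + 1) 1 1 T') :
    MomentLT (bipartiteGraphOf (hubRel g)) T' := by
  have hsum : ∑ j, leafCount g j = N + 3 := by simp [sum_leafCount hg]
  have hsq : ∑ j, leafCount g j ^ 2 ≤ (N + 1) ^ 2 + 2 :=
    sum_sq_le_of_forall_add_three_le hsum (by omega) h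
  have hcube : ∑ j, leafCount g j ^ 3 ≤ N * ∑ j, leafCount g j ^ 2 :=
    sum_cube_le_of_forall_add_three_le h
  unfold MomentLT
  rw [spectralMoment_four_hub hg, spectralMoment_six_hub hg, hT'.spectralMoment_four,
    hT'.spectralMoment_six, hsum, Fintype.card_fin]
  -- Equality does occur: counts $(3,3)$ against $(4,1,1)$ for $N=3$. The cubes then decide, because
  -- $N((N+1)^2+2)<(N+1)^3+2$.
  rcases hsq.lt_or_eq with hlt | heq
  · left
    have : ((∑ j, leafCount g j ^ 2 : ℕ) : ℝ) < (N + 1) ^ 2 + 2 := by exact_mod_cast hlt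
    push_cast at this ⊢
    linarith
  · right
    rw [heq] at hcube ⊢
    have : ((∑ j, leafCount g j ^ 3 : ℕ) : ℝ) ≤ N * ((N + 1) ^ 2 + 2) := by exact_mod_cast hcube
    push_cast at this ⊢
    constructor
    · ring
    · nlinarith

/-- For a black hub: `M` and `N` are exchanged, and $(M+1)^2+4$ is the value at the profile
$(M+1,2,0)$. -/
theorem spectralMoment_four_hub_le {g : Fin (M + 4) → Option (Fin (N + 4))}
    (hg : ∃! i, g i = none) (h : ∑ j, leafCount g j ^ 2 ≤ (M + 1) ^ 2 + 4) :
    spectralMoment (bipartiteGraphOf (hubRel g)) 4 ≤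
      2 * (((N : ℝ) + 4) ^ 2 + 2 * (M + 3) + ((M + 1) ^ 2 + 4)) := by
  have hsum : ∑ j, leafCount g j = M + 3 := by simp [sum_leafCount hg]
  rw [spectralMoment_four_hub hg, hsum, Fintype.card_fin]
  have : ((∑ j, leafCount g j ^ 2 : ℕ) : ℝ) ≤ (M + 1) ^ 2 + 4 := by exact_mod_cast h
  push_cast at this ⊢
  linarith

theorem MomentLT.congr_left {U : Type*} [Fintype U] {T'' : SimpleGraph U} (e : T ≃g T'')
    (h : MomentLT T'' T') : MomentLT T T' := by
  unfold MomentLT at *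
  rwa [spectralMoment_congr e, spectralMoment_congr e]

theorem bipartitionedTree_cases (hNM : N < M) (hT : IsBipartitionedTree n (N + 4) (M + 4) T)
    (hT' : IsHubTree (N + 4) (M + 4) (N + 1) 1 1 T') :
    IsHubTree (N + 4) (M + 4) (N + 3) 0 0 T ∨ IsHubTree (N + 4) (M + 4) (N + 2) 1 0 T ∨
      IsHubTree (N + 4) (M + 4) (N + 1) 2 0 T ∨ IsHubTree (N + 4) (M + 4) (N + 1) 1 1 T ∨
      IsHubTree (M + 4) (N + 4) (M + 2) 1 0 T ∨ MomentLT T T' := by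
  obtain ⟨r, ⟨e⟩⟩ := hT.exists_rel
  have hr := e.isTree_iff.1 hT.isTree
  have hr' := (bipartiteSwapIso r).isTree_iff.1 hr
  have hNM' : (N : ℝ) + 1 ≤ M := by exact_mod_cast hNM
  by_cases hrow : ∀ i, rowCount r i < M + 4
  · by_cases hcol : ∀ j, rowCount (fun j i => r i j) j < N + 4
    · have := spectralMoment_four_le_of_rowCount_lt hr hrow hcol
      refine .inr (.inr (.inr (.inr (.inr (.inl ?_)))))
      rw [spectralMoment_congr e, hT'.spectralMoment_four]
      push_cast
      nlinarith
    · push Not at hcol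
      obtain ⟨u, hu⟩ := hcol
      obtain ⟨g, hg, hgr⟩ := exists_hub_of_full_row hr' (u := u) (by simpa using hu)
      have e' := e.trans (bipartiteSwapIso r)
      -- A white vertex carrying all $M+3$ leaves would itself be a hub, which is excluded here.
      have hlc : ∀ i, leafCount g i < M + 3 := by
        intro i
        have h1 := rowCount_swap_hub hg i
        rw [← hgr] at h1
        have h2 := hrow i
        change rowCount r i = _ at h1
        omega
      rw [hgr] at e'
      have key : ∑ j, leafCount g j ^ 2 ≤ (M + 1) ^ 2 + 4 → MomentLT T T' := fun h => by
        have := spectralMoment_four_hub_le hg h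
        refine MomentLT.congr_left e' (.inl ?_)
        rw [hT'.spectralMoment_four]
        push_cast
        -- Half of the gap in $S_4$ is at least $4(M-N)-2$, positive because $N<M$.
        nlinarith
      have hsum : ∑ j, leafCount g j = M + 3 := by simp [sum_leafCount hg]
      rcases profile_cases (by simp) hsum with h | h | h | h | h
      · obtain ⟨x, -, -, -, -, -, hx, -⟩ := h
        exact absurd (hlc x) (by omega)
      · exact .inr (.inr (.inr (.inr (.inl ⟨g, hg, h, ⟨e'⟩⟩))))
      · refine .inr (.inr (.inr (.inr (.inr (key ?_)))))
        exact (h.sum_pow two_ne_zero).le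
      · refine .inr (.inr (.inr (.inr (.inr (key ?_)))))
        refine (h.sum_pow two_ne_zero).le.trans ?_
        change (M + 1) ^ 2 + _ + _ ≤ _
        omega
      · refine .inr (.inr (.inr (.inr (.inr (key ?_)))))
        refine (sum_sq_le_of_forall_add_three_le hsum (by omega) h).trans ?_
        change (M + 1) ^ 2 + _ ≤ _
        omega
  · push Not at hrow
    obtain ⟨u, hu⟩ := hrow
    obtain ⟨g, hg, rfl⟩ := exists_hub_of_full_row hr (u := u) (by simpa using hu)
    have hsum : ∑ j, leafCount g j = N + 3 := by simp [sum_leafCount hg]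
    rcases profile_cases (by simp) hsum with h | h | h | h | h
    · exact .inl ⟨g, hg, h, ⟨e⟩⟩
    · exact .inr (.inl ⟨g, hg, h, ⟨e⟩⟩)
    · exact .inr (.inr (.inl ⟨g, hg, h, ⟨e⟩⟩))
    · exact .inr (.inr (.inr (.inl ⟨g, hg, h, ⟨e⟩⟩)))
    · exact .inr (.inr (.inr (.inr (.inr
        (MomentLT.congr_left e (momentLT_of_leafCount_le hg h hT'))))))

end Classification

/-! ### Placing $D^{0,1}$ among the $B$-trees -/

theorem theorem3p1 (n p q : ℕ) (hp : 4 ≤ p) (hpq : p < q) (hn : p + q = n) :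
    ((p : ℝ) > ((q : ℝ) + 4) / 2 →
      AreLastTrees.{u} n p q [treeB p q 2 0, treeD p q 0 1, treeB p q 0 1, treeB p q 0 0]) ∧
    ((p : ℝ) = ((q : ℝ) + 4) / 2 →
      AreLastTrees.{u} n p q [treeD p q 0 1, treeB p q 2 0, treeB p q 0 1, treeB p q 0 0]) ∧
    ((p : ℝ) < ((q : ℝ) + 4) / 2 → 5 ≤ p →
      AreLastTrees.{u} n p q [treeB p q 0 2, treeB p q 2 0, treeB p q 0 1, treeB p q 0 0]) ∧
    (p = 4 →
      Nonempty (treeB p q 2 0 ≃g treeB p q 0 1) ∧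
      AreLastTrees.{u} n p q [treeB p q 0 2, treeB p q 0 1, treeB p q 0 0]) := by
  obtain ⟨N, rfl⟩ := Nat.exists_eq_add_of_le' hp
  obtain ⟨M, rfl⟩ := Nat.exists_eq_add_of_le' (hp.trans hpq.le)
  subst hn
  have hNM : N < M := by omega
  have hNM' : (N : ℝ) + 1 ≤ M := by exact_mod_cast hNM
  have hN0 : (0 : ℝ) ≤ N := Nat.cast_nonneg N
  have h00 := isHubTree_treeB_zero_zero N M
  have h01 := isHubTree_treeB_zero_one N M
  have h20 := isHubTree_treeB_two_zero N M
  have h02 := isHubTree_treeB_zero_two N M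
  have hD := isHubTree_treeD_zero_one N M
  have t00 := isBipartitionedTree_treeB (P := N) (Q := M) (k := 0) (l := 0) (by norm_num)
  have t01 := isBipartitionedTree_treeB (P := N) (Q := M) (k := 0) (l := 1) (by norm_num)
  have t20 := isBipartitionedTree_treeB (P := N) (Q := M) (k := 2) (l := 0) (by norm_num)
  have t02 := isBipartitionedTree_treeB (P := N) (Q := M) (k := 0) (l := 2) (by norm_num)
  have tD := isBipartitionedTree_treeD (P := N) (Q := M) (k := 0) (l := 1) (by norm_num)
  have lt_01_00 : MomentLT (treeB (N + 4) (M + 4) 0 1) (treeB (N + 4) (M + 4) 0 0) := by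
    left; rw [h01.spectralMoment_four, h00.spectralMoment_four]; push_cast; nlinarith
  have lt_02_20 : MomentLT (treeB (N + 4) (M + 4) 0 2) (treeB (N + 4) (M + 4) 2 0) := by
    left; rw [h02.spectralMoment_four, h20.spectralMoment_four]; push_cast; nlinarith
  have lt_02_01 : MomentLT (treeB (N + 4) (M + 4) 0 2) (treeB (N + 4) (M + 4) 0 1) := by
    left; rw [h02.spectralMoment_four, h01.spectralMoment_four]; push_cast; nlinarith
  have lt_D_01 : MomentLT (treeD (N + 4) (M + 4) 0 1) (treeB (N + 4) (M + 4) 0 1) := by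
    left; rw [hD.spectralMoment_four, h01.spectralMoment_four]; push_cast; nlinarith
  -- Half of the gap in $S_4$ is $2N$; for $N=0$ the two trees are isomorphic.
  have lt_20_01 : 1 ≤ N → MomentLT (treeB (N + 4) (M + 4) 2 0) (treeB (N + 4) (M + 4) 0 1) := by
    intro h1
    have h1' : (1 : ℝ) ≤ N := by exact_mod_cast h1
    left; rw [h20.spectralMoment_four, h01.spectralMoment_four]; push_cast; nlinarith
  have lt_D_02 : 2 * N + 1 ≤ M →
      MomentLT (treeD (N + 4) (M + 4) 0 1) (treeB (N + 4) (M + 4) 0 2) := by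
    intro h
    unfold MomentLT
    rw [hD.spectralMoment_four, h02.spectralMoment_four, hD.spectralMoment_six,
      h02.spectralMoment_six]
    rcases h.lt_or_eq with h | h
    · left
      have h' : 2 * (N : ℝ) + 1 < M := by exact_mod_cast h
      push_cast; nlinarith
    -- At $M=2N+1$ the fourth moments coincide and $S_6$ decides.
    · right
      subst h
      push_cast
      constructor
      · ring
      · have := mul_nonneg hN0 hN0
        have := mul_nonneg this hN0
        nlinarith
  have isEmpty_elim : ∀ {V : Type u} {T : SimpleGraph V} {G : SimpleGraph (Fin (N + 4) ⊕ Fin (M + 4))}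
      {p q a b c : ℕ}, IsHubTree p q a b c T → IsHubTree p q a b c G → IsEmpty (T ≃g G) → False :=
    fun h h' h'' => not_isEmpty_iff.2 (h.nonempty_iso h') h''
  refine ⟨fun h => ?_, fun h => ?_, fun h h5 => ?_, fun h => ?_⟩
  · have hMN : M < 2 * N := by
      have : (M : ℝ) < 2 * N := by push_cast at h; linarith
      exact_mod_cast this
    have hMN' : (M : ℝ) + 1 ≤ 2 * N := by exact_mod_cast hMN
    have lt_20_D : MomentLT (treeB (N + 4) (M + 4) 2 0) (treeD (N + 4) (M + 4) 0 1) := by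
      left; rw [h20.spectralMoment_four, hD.spectralMoment_four]; push_cast; nlinarith
    refine areLastTrees_cons (by omega) ?_ ?_ fun V _ T hT hL => ?_
    · simpa using ⟨t20, tD, t01, t00⟩
    · simpa using ⟨⟨lt_20_D, lt_20_01 (by omega), (lt_20_01 (by omega)).trans lt_01_00⟩,
        ⟨lt_D_01, lt_D_01.trans lt_01_00⟩, lt_01_00⟩
    · simp only [List.forall_mem_cons] at hL
      obtain ⟨e20, eD, e01, e00, -⟩ := hL
      rcases bipartitionedTree_cases hNM hT h02 with c | c | c | c | c | c
      · exact (isEmpty_elim c h00 e00).elim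
      · exact (isEmpty_elim c h01 e01).elim
      · exact (isEmpty_elim c h20 e20).elim
      · obtain ⟨e⟩ := c.nonempty_iso h02
        exact lt_02_20.congr_left e
      · exact (isEmpty_elim c hD eD).elim
      · exact c.trans lt_02_20
  · have hMN : M = 2 * N := by
      have : (M : ℝ) = 2 * N := by push_cast at h; linarith
      exact_mod_cast this
    have hN1 : 1 ≤ N := by omega
    subst hMN
    have hN1' : (1 : ℝ) ≤ N := by exact_mod_cast hN1
    have lt_D_20 : MomentLT (treeD (N + 4) (2 * N + 4) 0 1) (treeB (N + 4) (2 * N + 4) 2 0) := by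
      right
      rw [hD.spectralMoment_four, h20.spectralMoment_four, hD.spectralMoment_six,
        h20.spectralMoment_six]
      push_cast
      constructor
      · ring
      · have := mul_nonneg hN0 hN0
        have := mul_nonneg this hN0
        nlinarith
    have lt_02_D : MomentLT (treeB (N + 4) (2 * N + 4) 0 2) (treeD (N + 4) (2 * N + 4) 0 1) := by
      left; rw [h02.spectralMoment_four, hD.spectralMoment_four]; push_cast; nlinarith
    refine areLastTrees_cons (by omega) ?_ ?_ fun V _ T hT hL => ?_
    · simpa using ⟨tD, t20, t01, t00⟩
    · simpa using ⟨⟨lt_D_20, lt_D_01, lt_D_01.trans lt_01_00⟩,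
        ⟨lt_20_01 hN1, (lt_20_01 hN1).trans lt_01_00⟩, lt_01_00⟩
    · simp only [List.forall_mem_cons] at hL
      obtain ⟨eD, e20, e01, e00, -⟩ := hL
      rcases bipartitionedTree_cases hNM hT h02 with c | c | c | c | c | c
      · exact (isEmpty_elim c h00 e00).elim
      · exact (isEmpty_elim c h01 e01).elim
      · exact (isEmpty_elim c h20 e20).elim
      · obtain ⟨e⟩ := c.nonempty_iso h02
        exact lt_02_D.congr_left e
      · exact (isEmpty_elim c hD eD).elim
      · exact c.trans lt_02_D
  · have hMN : 2 * N < M := by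
      have : 2 * (N : ℝ) < M := by push_cast at h; linarith
      exact_mod_cast this
    have hN1 : 1 ≤ N := by omega
    refine areLastTrees_cons (by omega) ?_ ?_ fun V _ T hT hL => ?_
    · simpa using ⟨t02, t20, t01, t00⟩
    · simpa using ⟨⟨lt_02_20, lt_02_01, lt_02_01.trans lt_01_00⟩,
        ⟨lt_20_01 hN1, (lt_20_01 hN1).trans lt_01_00⟩, lt_01_00⟩
    · simp only [List.forall_mem_cons] at hL
      obtain ⟨e02, e20, e01, e00, -⟩ := hL
      rcases bipartitionedTree_cases hNM hT h02 with c | c | c | c | c | c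
      · exact (isEmpty_elim c h00 e00).elim
      · exact (isEmpty_elim c h01 e01).elim
      · exact (isEmpty_elim c h20 e20).elim
      · exact (isEmpty_elim c h02 e02).elim
      · obtain ⟨e⟩ := c.nonempty_iso hD
        exact (lt_D_02 (by omega)).congr_left e
      · exact c
  · obtain rfl : N = 0 := by omega
    -- For $p=4$ the profiles $(1,2,0)$ and $(2,1,0)$ differ only in order.
    have swap : ∀ {V : Type u} {T : SimpleGraph V}, IsHubTree (0 + 4) (M + 4) (0 + 1) 2 0 T →
        IsHubTree (0 + 4) (M + 4) (0 + 2) 1 0 T :=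
      fun ⟨g, h1, h2, h3⟩ => ⟨g, h1, h2.swap, h3⟩
    refine ⟨?_, areLastTrees_cons (by omega) ?_ ?_ fun V _ T hT hL => ?_⟩
    · obtain ⟨g, h1, h2, h3⟩ := h20
      exact IsHubTree.nonempty_iso ⟨g, h1, h2.swap, h3⟩ h01
    · simpa using ⟨t02, t01, t00⟩
    · simpa using ⟨⟨lt_02_01, lt_02_01.trans lt_01_00⟩, lt_01_00⟩
    · simp only [List.forall_mem_cons] at hL
      obtain ⟨e02, e01, e00, -⟩ := hL
      rcases bipartitionedTree_cases hNM hT h02 with c | c | c | c | c | c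
      · exact (isEmpty_elim c h00 e00).elim
      · exact (isEmpty_elim c h01 e01).elim
      · exact (isEmpty_elim (swap c) h01 e01).elim
      · exact (isEmpty_elim c h02 e02).elim
      · obtain ⟨e⟩ := c.nonempty_iso hD
        exact (lt_D_02 (by omega)).congr_left e
      · exact c
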